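/- Let $\mathcal Z=\mathbb R^{n}$ (joint states of an ego vehicle and a contender) and $\mathcal Z_{\mathrm E}=\mathbb R^{n_{\mathrm E}}$ (ego states), and let $\pi:\mathcal Z\to\mathcal Z_{\mathrm E}$, $z\mapsto z_{\mathrm E}$, be a linear projection. Let $\mathcal U^{\mathrm E}\subset\mathbb R^{m_{\mathrm E}}$ and $\mathcal U^{\mathrm C}\subset\mathbb R^{m_{\mathrm C}}$ be nonempty compact control sets, let $\dot z_{\mathrm E}=f_{\mathrm E}(z_{\mathrm E},u_{\mathrm E})$ be the ego dynamics and $\dot z=f(z,u_{\mathrm E},u_{\mathrm C})$ the joint dynamics, with $\pi f(z,u_{\mathrm E},u_{\mathrm C})=f_{\mathrm E}(\pi z,u_{\mathrm E})$ for all $z\in\mathcal Z$, $u_{\mathrm E}\in\mathcal U^{\mathrm E}$, $u_{\mathrm C}\in\mathcal U^{\mathrm C}$. Assume that $f$ and $f_{\mathrm E}$ are continuous, locally Lipschitz in the state uniformly in the controls, and of at most linear growth in the state uniformly in the controls. Let $T\ge 0$, let $\mathcal C_{\mathrm E}=\{z_{\mathrm E}\mid \mathcal G_{\mathrm E}(z_{\mathrm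 E})\le 0\}$ be the set of ego states that complete the maneuver, and let $\{z\mid\mathcal G_{\mathrm{col}}(z)\le 0\}$ be the set of joint states in which the two vehicles are in collision, where $\mathcal G_{\mathrm E}:\mathcal Z_{\mathrm E}\to\mathbb R$ and $\mathcal G_{\mathrm{col}}:\mathcal Z\to\mathbb R$. Let $V_{\mathrm E}:\mathcal Z_{\mathrm E}\times[0,T]\to\mathbb R$ be a continuous viscosity solution of $$\frac{\partial V_{\mathrm E}}{\partial \tau}+\min\Bigl\{0,\min_{u_{\mathrm E}\in\mathcal U^{\mathrm E}}\nabla_{z_{\mathrm E}}V_{\mathrm E}(z_{\mathrm E},\tau)^{\top}f_{\mathrm E}(z_{\mathrm E},u_{\mathrm E})\Bigr\}=0\ \text{ on } \mathcal Z_{\mathrm E}\times(0,T),\qquad V_{\mathrm E}(z_{\mathrm E},T)=\mathcal G_{\mathrm E}(z_{\mathrm E}).$$ For every $t\in[0,T]$ let $V^t:\mathcal Z\times[0,t]\to\mathbb R$ be a continuous viscosity solution of $$\frac{\partial V^t}{\partial \tau}+\min_{u_{\mathrm C}\in\mathcal U^{\mathrm C}}\min_{u_{\mathrm E}\in\mathcal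 U^{\mathrm E}}\nabla_zV^t(z,\tau)^{\top}f(z,u_{\mathrm E},u_{\mathrm C})=0\ \text{ on } \mathcal Z\times(0,t),\qquad V^t(z,t)=\max\{V_{\mathrm E}(\pi z,t),\mathcal G_{\mathrm{col}}(z)\}.$$ Let $V(z)=\min_{t\in[0,T]}V^t(z,0)$ (it suffices that $V(z)$ is the infimum, assumed finite). Then, for every $z_0\in\mathcal Z$ with $V(z_0)<0$, there are a time $t\in[0,T]$ and measurable control signals $u_{\mathrm E}:[0,T]\to\mathcal U^{\mathrm E}$ and $u_{\mathrm C}:[0,t]\to\mathcal U^{\mathrm C}$ such that the ego and the contender collide at time $t$ and the ego completes the maneuver by time $T$. That is, there are a (Carathéodory) solution $z$ of $\dot z=f(z,u_{\mathrm E},u_{\mathrm C})$ on $[0,t]$ with $z(0)=z_0$ and a solution $z_{\mathrm E}$ of $\dot z_{\mathrm E}=f_{\mathrm E}(z_{\mathrm E},u_{\mathrm E})$ on $[0,T]$ with $z_{\mathrm E}(0)=\pi z_0$ such that $z_{\mathrm E}=\pi z$ on $[0,t]$, $\mathcal G_{\mathrm{col}}(z(t))\le 0$, and $z_{\mathrm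 E}(s)\in\mathcal C_{\mathrm E}$ for some $s\in[t,T]$. Here a continuous $W$ is a viscosity solution of $\partial_\tau W+H(x,\nabla_xW)=0$ on $\mathbb R^k\times(0,b)$ with prescribed terminal value at $b$ if, for every $C^1$ function $\varphi$ on $\mathbb R^k\times\mathbb R$ and every $(x,\tau)\in\mathbb R^k\times(0,b)$, $\partial_\tau\varphi+H(x,\nabla_x\varphi)\ge0$ at $(x,\tau)$ whenever $W-\varphi$ has a local maximum there, and $\le0$ whenever $W-\varphi$ has a local minimum there. -/

import Mathlib

open Set MeasureTheory

/-- `ℝⁿ` with its Euclidean norm. -/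
abbrev RVec (n : ℕ) : Type := EuclideanSpace ℝ (Fin n)

section PDE

variable {X : Type*} [NormedAddCommGroup X] [NormedSpace ℝ X]

/-- `V` is a continuous viscosity solution (in the sense of Crandall and Lions) of the terminal
value problem `∂V/∂τ + H (x, ∇ₓV) = 0` on `X × (0, b)`, `V (x, b) = g x`.
The gradient is represented by the differential, a continuous linear form on `X`, so that
`∇ₓV ᵀ v` is `p v`.  Only the values of `V` on `X × [0, b]` matter.  The inequalities have the
orientation that belongs to terminal (as opposed to initial) value problems. -/
structure IsViscositySolution (H : X → (X →L[ℝ] ℝ) → ℝ) (b : ℝ) (g : X → ℝ)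
    (V : X → ℝ → ℝ) : Prop where
  continuousOn : ContinuousOn (fun p : X × ℝ => V p.1 p.2) (univ ×ˢ Icc 0 b)
  terminal : ∀ x, V x b = g x
  subsolution : ∀ φ : X → ℝ → ℝ, ContDiff ℝ 1 (fun p : X × ℝ => φ p.1 p.2) →
    ∀ (x : X) (τ : ℝ), τ ∈ Ioo 0 b →
      IsLocalMax (fun p : X × ℝ => V p.1 p.2 - φ p.1 p.2) (x, τ) →
      0 ≤ deriv (fun s => φ x s) τ + H x (fderiv ℝ (fun y => φ y τ) x)
  supersolution : ∀ φ : X → ℝ → ℝ, ContDiff ℝ 1 (fun p : X × ℝ => φ p.1 p.2) →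
    ∀ (x : X) (τ : ℝ), τ ∈ Ioo 0 b →
      IsLocalMin (fun p : X × ℝ => V p.1 p.2 - φ p.1 p.2) (x, τ) →
      deriv (fun s => φ x s) τ + H x (fderiv ℝ (fun y => φ y τ) x) ≤ 0

/-- `min {0, min_{u ∈ U} pᵀ f(x, u)}`: the Hamiltonian for reaching a target at any time up to the
end of the horizon.  The inner minimum is attained for compact nonempty `U` and continuous `f`. -/
noncomputable def reachAnytimeHamiltonian {A : Type*} (U : Set A) (f : X → A → X)
    (x : X) (p : X →L[ℝ] ℝ) : ℝ :=
  min 0 (sInf ((fun u => p (f x u)) '' U))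

/-- `min_{u_C ∈ U_C} min_{u_E ∈ U_E} pᵀ f(x, u_E, u_C)`: the Hamiltonian of two cooperating
agents. -/
noncomputable def twoAgentHamiltonian {A B : Type*} (UE : Set A) (UC : Set B)
    (f : X → A → B → X) (x : X) (p : X →L[ℝ] ℝ) : ℝ :=
  sInf ((fun uC => sInf ((fun uE => p (f x uE uC)) '' UE)) '' UC)

/-- Standing regularity of a control system `ẋ = f(x, u)`, `u ∈ U`: the control set is compact and
nonempty, `f` is continuous, locally Lipschitz in the state uniformly in the control, and of at most
linear growth in the state. -/
structure RegularDynamics {A : Type*} [TopologicalSpace A] (U : Set A) (f : X → A → X) :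
    Prop where
  isCompact : IsCompact U
  nonempty : U.Nonempty
  continuousOn : ContinuousOn (fun p : X × A => f p.1 p.2) (univ ×ˢ U)
  locallyLipschitz : ∀ R : ℝ, ∃ L : ℝ, ∀ u ∈ U, ∀ x y : X, ‖x‖ ≤ R → ‖y‖ ≤ R →
    ‖f x u - f y u‖ ≤ L * ‖x - y‖
  linearGrowth : ∃ K : ℝ, ∀ u ∈ U, ∀ x : X, ‖f x u‖ ≤ K * (1 + ‖x‖)

/-- `u` is a (measurable) control signal on `[0, b]` with values in `U`. -/
def IsControl {A : Type*} [MeasurableSpace A] (U : Set A) (b : ℝ) (u : ℝ → A) : Prop :=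
  Measurable u ∧ ∀ τ ∈ Icc 0 b, u τ ∈ U

/-- `x` is the trajectory on `[0, b]` of `ẋ = f(x, u)` from `x₀` under the control signal `u`
(a solution in the sense of Carathéodory, written as an integral equation). -/
structure IsTrajectory {A : Type*} (f : X → A → X) (b : ℝ) (u : ℝ → A) (x₀ : X)
    (x : ℝ → X) : Prop where
  continuousOn : ContinuousOn x (Icc 0 b)
  integrable : IntervalIntegrable (fun s => f (x s) (u s)) volume 0 b
  eq_integral : ∀ τ ∈ Icc 0 b, x τ = x₀ + ∫ s in (0 : ℝ)..τ, f (x s) (u s)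

end PDE

/-!
A negative value of a viscosity solution is turned into a trajectory by proximal aiming; neither a
comparison principle nor a representation formula for the solution is needed, and only the
supersolution half of the definition is used.

Let `V` solve the terminal value problem on `[0, b]` with `V x₀ a < 0`. At a state `x` and a time
`τ`, minimise `V y s + k * (‖x - y‖ ^ 2 + (τ - s) ^ 2)` over `(y, s)` in a large compact set. For
large `k` the minimiser is close to `(x, τ)`, and `k * ‖x - y‖ ^ 2` is small because `V` is
uniformly continuous there. The quadratic touches `V` from below at the minimiser, so the
supersolution inequality gives a control `u` whose velocity `f y u` raises the penalised value to
first order by an arbitrarily small amount at most (`IsViscositySolution.exists_aiming_control`).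
Using `u` at `x` for a short time `h` raises the minimum by at most a small multiple of `h`: the
velocities `f x u` and `f y u` differ by `O(‖x - y‖)`, which costs `O(h * k * ‖x - y‖ ^ 2)`, and
the remaining error is `O(k * h ^ 2)` (`penalty_step_le`). After finitely many steps the terminal
value is still negative, because the initial inequality is strict
(`IsViscositySolution.exists_terminal_neg`). The controls are piecewise constant, so neither
relaxed controls nor measurable selections occur.

For the joint system, `V z₀ < 0` gives a time `t` with `Vt t z₀ 0 < 0`, hence a joint trajectory
with `max (VE (π (z t)) t) (Gcol (z t)) < 0` (`RegularDynamics.exists_trajectory_terminal_neg`):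
the vehicles collide at time `t` and the ego value is negative there. The Hamiltonian of the ego
problem is that of a system which may also wait; deleting the waiting periods gives a trajectory
of the ego dynamics that enters the maneuver set no later than `T`
(`RegularDynamics.exists_prolongation_reaching`).
-/

/-! ### Trajectories under constant controls -/

section Trajectories

/-- A property that survives all sufficiently short time steps reaches the end of the horizon. -/
theorem exists_of_small_steps {Y : Type*} {Q : ℝ → Y → Prop} {a b h₀ : ℝ} (hab : a ≤ b)
    (hh₀ : 0 < h₀)
    (step : ∀ τ h x, a ≤ τ → 0 < h → h ≤ h₀ → τ + h ≤ b → Q τ x → ∃ x', Q (τ + h) x')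
    {x : Y} (hx : Q a x) : ∃ x', Q b x' := by
  rcases hab.eq_or_lt with rfl | hab
  · exact ⟨x, hx⟩
  obtain ⟨N, hN⟩ := exists_nat_gt ((b - a) / h₀)
  have hN0 : (0 : ℝ) < N := lt_of_le_of_lt (div_nonneg (sub_nonneg.2 hab.le) hh₀.le) hN
  set h := (b - a) / N with hdef
  have hh : 0 < h := div_pos (sub_pos.2 hab) hN0
  have hhle : h ≤ h₀ := by
    rw [div_lt_iff₀ hh₀] at hN
    rw [hdef, div_le_iff₀ hN0]
    linarith
  have hNh : N * h = b - a := by rw [hdef]; field_simp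
  have key : ∀ j : ℕ, j ≤ N → ∃ x', Q (a + j * h) x' := by
    intro j
    induction j with
    | zero => intro _; exact ⟨x, by simpa using hx⟩
    | succ j ih =>
      intro hj
      obtain ⟨x', hx'⟩ := ih (by omega)
      have hj' : ((j + 1 : ℕ) : ℝ) * h ≤ N * h :=
        mul_le_mul_of_nonneg_right (by exact_mod_cast hj) hh.le
      have e : a + ((j + 1 : ℕ) : ℝ) * h = a + j * h + h := by push_cast; ring
      rw [e] at *
      refine step _ h x' ?_ hh hhle ?_ hx'
      · have : (0 : ℝ) ≤ j * h := by positivity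
        linarith
      · push_cast at hj'
        linarith
  obtain ⟨x', hx'⟩ := key N le_rfl
  rw [hNh] at hx'
  exact ⟨x', by simpa using hx'⟩

variable {X : Type*} [NormedAddCommGroup X] [NormedSpace ℝ X]

/-- Existence of a short trajectory under a constant control, with the exponential growth bound,
the speed bound, and the second-order error of the Euler step. -/
theorem exists_short_trajectory [CompleteSpace X] {A : Type*} {f : X → A → X} {u : A}
    {K L R : ℝ} (hK : 0 < K) (hL : 0 ≤ L)
    (hgrowth : ∀ x, ‖f x u‖ ≤ K * (1 + ‖x‖))
    (hlip : ∀ x y : X, ‖x‖ ≤ R + 1 → ‖y‖ ≤ R + 1 → ‖f x u - f y u‖ ≤ L * ‖x - y‖)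
    {x : X} {h : ℝ} (hh : 0 ≤ h) (hsmall : h * (K * (R + 2)) ≤ 1)
    (hx : (1 + ‖x‖) * Real.exp (K * h) ≤ 1 + R) :
    ∃ y : ℝ → X, IsTrajectory f h (fun _ => u) x y ∧
      1 + ‖y h‖ ≤ (1 + ‖x‖) * Real.exp (K * h) ∧
      ‖y h - x‖ ≤ K * (R + 2) * h ∧
      ‖y h - x - h • f x u‖ ≤ L * (K * (R + 2)) * h ^ 2 := by
  have hxR : ‖x‖ ≤ R := by
    have : 1 + ‖x‖ ≤ (1 + ‖x‖) * Real.exp (K * h) :=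
      le_mul_of_one_le_right (by positivity) (Real.one_le_exp (by positivity))
    linarith
  have hR : 0 ≤ R := (norm_nonneg x).trans hxR
  have hM : 0 ≤ K * (R + 2) := by positivity
  have hball : ∀ y ∈ Metric.closedBall x 1, ‖y‖ ≤ R + 1 := fun y hy => by
    have h1 : ‖y - x‖ ≤ 1 := by simpa [dist_eq_norm] using hy
    have h2 : ‖y‖ ≤ ‖x‖ + ‖y - x‖ := norm_le_norm_add_norm_sub' y x |>.trans (by linarith)
    linarith
  have hPL : IsPicardLindelof (fun _ z => f z u) (tmin := 0) (tmax := h) ⟨0, le_rfl, hh⟩ x 1 0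
      ⟨K * (R + 2), hM⟩ ⟨L, hL⟩ := by
    refine ⟨fun t _ => ?_, fun z _ => continuousOn_const, fun t _ z hz => ?_, ?_⟩
    · refine LipschitzOnWith.of_dist_le_mul fun z hz w hw => ?_
      rw [dist_eq_norm, dist_eq_norm]
      exact hlip z w (hball z (by simpa using hz)) (hball w (by simpa using hw))
    · refine (hgrowth z).trans ?_
      have := hball z (by simpa using hz)
      exact mul_le_mul_of_nonneg_left (by linarith) hK.le
    · simp only [sub_zero, sub_self, NNReal.coe_one, NNReal.coe_zero]
      rw [max_eq_left hh]
      exact (mul_comm _ _).trans_le hsmall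
  obtain ⟨y, hy0, hyd⟩ := hPL.exists_eq_forall_mem_Icc_hasDerivWithinAt₀
  simp only at hy0
  have hyc : ContinuousOn y (Icc 0 h) := fun s hs => (hyd s hs).continuousWithinAt
  have hyr : ∀ s ∈ Ico 0 h, HasDerivWithinAt y (f (y s) u) (Ici s) s := fun s hs =>
    (hyd s (Ico_subset_Icc_self hs)).mono_of_mem_nhdsWithin
      (Filter.mem_of_superset (Icc_mem_nhdsGE hs.2) (Icc_subset_Icc_left hs.1))
  -- Gronwall's inequality applies to `1 + ‖y‖`.
  have hgr : ∀ s ∈ Icc 0 h, 1 + ‖y s‖ ≤ (1 + ‖x‖) * Real.exp (K * s) := by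
    intro s hs
    have := norm_le_gronwallBound_of_norm_deriv_right_le (δ := ‖x‖) (K := K) (ε := K) hyc hyr
      (by rw [hy0]) (fun s _ => (hgrowth (y s)).trans (by linarith)) s hs
    rw [gronwallBound_of_K_ne_0 hK.ne', sub_zero, div_self hK.ne'] at this
    linarith
  have hyR : ∀ s ∈ Icc 0 h, ‖y s‖ ≤ R := by
    intro s hs
    have h1 := hgr s hs
    have h2 : (1 + ‖x‖) * Real.exp (K * s) ≤ (1 + ‖x‖) * Real.exp (K * h) := by
      gcongr
      exact hs.2
    linarith
  have hfc : ContinuousOn (fun s => f (y s) u) (Icc 0 h) := by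
    have : ContinuousOn (fun z => f z u) (Metric.closedBall 0 (R + 1)) := by
      refine (LipschitzOnWith.of_dist_le_mul (K := ⟨L, hL⟩) fun z hz w hw => ?_).continuousOn
      rw [dist_eq_norm, dist_eq_norm]
      exact hlip z w (by simpa using hz) (by simpa using hw)
    refine this.comp hyc fun s hs => ?_
    simpa using (hyR s hs).trans (by linarith)
  have hspeed : ∀ s ∈ Icc 0 h, ‖y s - x‖ ≤ K * (R + 2) * s := by
    intro s hs
    have := norm_image_sub_le_of_norm_deriv_right_le_segment (C := K * (R + 2)) hyc hyr
      (fun r hr => (hgrowth (y r)).trans (mul_le_mul_of_nonneg_left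
        (by have := hyR r (Ico_subset_Icc_self hr); linarith) hK.le)) s hs
    rwa [hy0, sub_zero] at this
  refine ⟨y, ⟨hyc, (hfc.intervalIntegrable_of_Icc hh), fun τ hτ => ?_⟩,
    hgr h ⟨hh, le_rfl⟩, hspeed h ⟨hh, le_rfl⟩, ?_⟩
  · have hsub : Icc 0 τ ⊆ Icc 0 h := Icc_subset_Icc_right hτ.2
    rw [intervalIntegral.integral_eq_sub_of_hasDeriv_right_of_le hτ.1 (hyc.mono hsub)
      (fun s hs => (hyr s ⟨hs.1.le, hs.2.trans_le hτ.2⟩).mono Ioi_subset_Ici_self)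
      ((hfc.mono hsub).intervalIntegrable_of_Icc hτ.1), hy0]
    abel
  · have := norm_image_sub_le_of_norm_deriv_right_le_segment (a := 0) (b := h)
      (f := fun s => y s - s • f x u) (f' := fun s => f (y s) u - f x u)
      (C := L * (K * (R + 2)) * h) (hyc.sub (by fun_prop))
      (fun r hr => by
        have := (hyr r hr).sub ((hasDerivWithinAt_id r _).smul_const (f x u))
        rwa [one_smul] at this)
      (fun r hr => by
        have hr' := Ico_subset_Icc_self hr
        have h1 := hlip (y r) x ((hyR r hr').trans (by linarith)) (hxR.trans (by linarith))
        have h2 : L * ‖y r - x‖ ≤ L * (K * (R + 2) * h) := by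
          refine mul_le_mul_of_nonneg_left ((hspeed r hr').trans ?_) hL
          exact mul_le_mul_of_nonneg_left hr.2.le hM
        linarith) h ⟨hh, le_rfl⟩
    simp only [hy0, zero_smul, sub_zero] at this
    calc ‖y h - x - h • f x u‖ = ‖y h - h • f x u - x‖ := by congr 1; abel
      _ ≤ _ := this
      _ = _ := by ring

/-- Two trajectories, the second starting where the first ends, run one after the other. -/
theorem IsTrajectory.concat {A : Type*} {f : X → A → X} {a h : ℝ} (ha : 0 ≤ a) (hh : 0 ≤ h)
    {u v : ℝ → A} {x₀ : X} {x y : ℝ → X} (hx : IsTrajectory f a u x₀ x)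
    (hy : IsTrajectory f h v (x a) y) :
    IsTrajectory f (a + h) (fun s => if s ≤ a then u s else v (s - a)) x₀
      (fun s => if s ≤ a then x s else y (s - a)) := by
  have hy0 : y 0 = x a := by simpa using hy.eq_integral 0 ⟨le_rfl, hh⟩
  set w : ℝ → A := fun s => if s ≤ a then u s else v (s - a) with hw
  set z : ℝ → X := fun s => if s ≤ a then x s else y (s - a) with hz
  have hza : ∀ s, s ≤ a → z s = x s := fun s hs => if_pos hs
  have hzb : ∀ s, a ≤ s → z s = y (s - a) := fun s hs => by
    rcases hs.eq_or_lt with rfl | hs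
    · simp [hz, hy0]
    · exact if_neg (not_le.2 hs)
  have hI1 : ∀ τ ∈ Icc 0 a, IntervalIntegrable (fun s => f (x s) (u s)) volume 0 τ := fun τ hτ =>
    hx.integrable.mono_set (by
      rw [uIcc_of_le hτ.1, uIcc_of_le ha]; exact Icc_subset_Icc_right hτ.2)
  have hF1 : ∀ τ ∈ Icc 0 a, EqOn (fun s => f (x s) (u s)) (fun s => f (z s) (w s)) (uIcc 0 τ) := by
    intro τ hτ s hs
    rw [uIcc_of_le hτ.1] at hs
    have : s ≤ a := hs.2.trans hτ.2
    simp [hz, hw, this]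
  have hF2 : ∀ τ, a ≤ τ →
      EqOn (fun s => f (y (s - a)) (v (s - a))) (fun s => f (z s) (w s)) (uIoc a τ) := by
    intro τ hτ s hs
    rw [uIoc_of_le hτ] at hs
    simp [hz, hw, not_le.2 hs.1]
  have hI2 : ∀ τ ∈ Icc a (a + h),
      IntervalIntegrable (fun s => f (y (s - a)) (v (s - a))) volume a τ := by
    intro τ hτ
    have h1 : IntervalIntegrable (fun s => f (y s) (v s)) volume 0 (τ - a) :=
      hy.integrable.mono_set (by
        rw [uIcc_of_le (sub_nonneg.2 hτ.1), uIcc_of_le hh]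
        exact Icc_subset_Icc_right (by linarith [hτ.2]))
    simpa using h1.comp_sub_right a
  have hI1' : IntervalIntegrable (fun s => f (z s) (w s)) volume 0 a :=
    (hI1 a ⟨ha, le_rfl⟩).congr ((hF1 a ⟨ha, le_rfl⟩).mono uIoc_subset_uIcc)
  refine ⟨?_, ?_, fun τ hτ => ?_⟩
  · rw [← Icc_union_Icc_eq_Icc ha (le_add_of_nonneg_right hh)]
    refine ContinuousOn.union_of_isClosed ?_ ?_ isClosed_Icc isClosed_Icc
    · exact hx.continuousOn.congr fun s hs => hza s hs.2
    · refine ContinuousOn.congr (f := fun s => y (s - a)) ?_ fun s hs => hzb s hs.1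
      exact hy.continuousOn.comp (by fun_prop)
        fun s hs => ⟨by linarith [hs.1], by linarith [hs.2]⟩
  · exact hI1'.trans ((hI2 (a + h) ⟨by linarith, le_rfl⟩).congr (hF2 (a + h) (by linarith)))
  · rcases le_total τ a with h1 | h1
    · rw [hza τ h1, hx.eq_integral τ ⟨hτ.1, h1⟩,
        intervalIntegral.integral_congr (hF1 τ ⟨hτ.1, h1⟩)]
    · have h2 : IntervalIntegrable (fun s => f (z s) (w s)) volume a τ :=
        (hI2 τ ⟨h1, hτ.2⟩).congr (hF2 τ h1)
      rw [hzb τ h1, hy.eq_integral (τ - a) ⟨by linarith, by linarith [hτ.2]⟩,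
        hx.eq_integral a ⟨ha, le_rfl⟩, intervalIntegral.integral_congr (hF1 a ⟨ha, le_rfl⟩),
        ← intervalIntegral.integral_add_adjacent_intervals hI1' h2, add_assoc]
      congr 2
      rw [← intervalIntegral.integral_congr_ae (ae_of_all _ fun s hs => hF2 τ h1 hs)]
      simp [intervalIntegral.integral_comp_sub_right (fun s => f (y s) (v s)) a]

/-- The constant control `u` appended to a control signal. -/
theorem IsControl.concat_const {A : Type*} [MeasurableSpace A] {U : Set A} {a h : ℝ} {u : ℝ → A}
    (hu : IsControl U a u) {v : A} (hv : v ∈ U) :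
    IsControl U (a + h) (fun s => if s ≤ a then u s else v) := by
  refine ⟨hu.1.ite measurableSet_Iic measurable_const, fun τ hτ => ?_⟩
  dsimp only
  split_ifs with h1
  · exact hu.2 τ ⟨hτ.1, h1⟩
  · exact hv

end Trajectories

/-- Every constant control has a trajectory on every bounded time interval. -/
theorem RegularDynamics.exists_trajectory {X : Type*} [NormedAddCommGroup X] [NormedSpace ℝ X]
    [CompleteSpace X] {A : Type*} [TopologicalSpace A] {U : Set A} {f : X → A → X}
    (hf : RegularDynamics U f) {u : A} (hu : u ∈ U) (x : X) {T : ℝ} (hT : 0 ≤ T) :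
    ∃ y, IsTrajectory f T (fun _ => u) x y := by
  obtain ⟨K₀, hK₀⟩ := hf.linearGrowth
  set K := max K₀ 1
  have hK : 0 < K := lt_max_of_lt_right one_pos
  set R := (1 + ‖x‖) * Real.exp (K * T)
  have hR : 0 < R := by positivity
  obtain ⟨L₀, hL₀⟩ := hf.locallyLipschitz (R + 1)
  have hgrowth : ∀ y, ‖f y u‖ ≤ K * (1 + ‖y‖) := fun y => (hK₀ u hu y).trans
    (mul_le_mul_of_nonneg_right (le_max_left _ _) (by positivity))
  have hlip : ∀ y z : X, ‖y‖ ≤ R + 1 → ‖z‖ ≤ R + 1 →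
      ‖f y u - f z u‖ ≤ max L₀ 0 * ‖y - z‖ := fun y z hy hz => (hL₀ u hu y z hy hz).trans
    (mul_le_mul_of_nonneg_right (le_max_left _ _) (by positivity))
  have hM : 0 < K * (R + 2) := by positivity
  obtain ⟨x', _, y, hy, _⟩ := exists_of_small_steps
    (Q := fun τ x' => 1 + ‖x'‖ ≤ (1 + ‖x‖) * Real.exp (K * τ) ∧
      ∃ y, IsTrajectory f τ (fun _ => u) x y ∧ y τ = x') (x := x) hT (one_div_pos.2 hM)
    (by
      rintro τ h _ hτ hh hhM hτh ⟨hb, y, hy, rfl⟩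
      have hexp : (1 + ‖y τ‖) * Real.exp (K * h) ≤ (1 + ‖x‖) * Real.exp (K * (τ + h)) := by
        rw [mul_add, Real.exp_add, ← mul_assoc]
        exact mul_le_mul_of_nonneg_right hb (Real.exp_pos _).le
      have hle : (1 + ‖x‖) * Real.exp (K * (τ + h)) ≤ R := by
        simp only [R]
        gcongr
      obtain ⟨y', hy', hb', -, -⟩ := exists_short_trajectory hK (le_max_right L₀ 0) hgrowth hlip
        hh.le ((le_div_iff₀ hM).1 hhM) (x := y τ) (by linarith)
      have := hy.concat hτ hh.le hy'
      simp only [ite_self] at this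
      exact ⟨_, hb'.trans hexp, _, this, by simp [hh]⟩)
    ⟨by simp, fun _ => x, ⟨continuousOn_const, by simp, fun τ hτ => by
      simp [le_antisymm hτ.2 hτ.1]⟩, rfl⟩
  exact ⟨y, hy⟩

/-! ### Descent along a viscosity supersolution -/

section Descent

variable {X : Type*} [NormedAddCommGroup X] [InnerProductSpace ℝ X]

open scoped RealInnerProductSpace

/-- The supersolution inequality tested with a concave quadratic that touches `V` from below at
`(y, s)`: the Hamiltonian supplies a control that is nearly optimal at `y` in the direction
of the aiming vector `x - y`. -/
theorem IsViscositySolution.exists_aiming_control {A : Type*} {U : Set A} {f : X → A → X}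
    {H : X → (X →L[ℝ] ℝ) → ℝ} {b : ℝ} {g : X → ℝ} {V : X → ℝ → ℝ}
    (hV : IsViscositySolution H b g V)
    (hH : ∀ x p c, H x p < c → ∃ u ∈ U, p (f x u) < c)
    {k τ s ω : ℝ} {x y : X} (hs : s ∈ Ioo 0 b) (hω : 0 < ω)
    (hmin : IsLocalMin (fun p : X × ℝ => V p.1 p.2 + k * (‖x - p.1‖ ^ 2 + (τ - p.2) ^ 2)) (y, s)) :
    ∃ u ∈ U, 2 * k * (τ - s) + 2 * k * ⟪x - y, f y u⟫ < ω := by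
  have h := hV.supersolution (fun y s => -(k * (‖x - y‖ ^ 2 + (τ - s) ^ 2)))
    (by
      have : ContDiff ℝ 1 (fun p : X × ℝ => ‖x - p.1‖ ^ 2) :=
        (contDiff_const.sub contDiff_fst).norm_sq ℝ
      fun_prop) y s hs (by simpa using hmin)
  have hd : deriv (fun s => -(k * (‖x - y‖ ^ 2 + (τ - s) ^ 2))) s = 2 * k * (τ - s) := by
    have : HasDerivAt (fun s => -(k * (‖x - y‖ ^ 2 + (τ - s) ^ 2)))
        (-(k * ((2 : ℕ) * (τ - s) ^ (2 - 1) * (-1)))) s :=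
      ((((hasDerivAt_id s).const_sub τ).pow 2).const_add _ |>.const_mul k).neg
    rw [this.deriv]
    push_cast
    ring
  have hg : ∀ v, fderiv ℝ (fun y => -(k * (‖x - y‖ ^ 2 + (τ - s) ^ 2))) y v =
      2 * k * ⟪x - y, v⟫ := by
    intro v
    have := ((((hasFDerivAt_id (𝕜 := ℝ) y).const_sub x).norm_sq.add_const
      ((τ - s) ^ 2)).const_mul k).neg
    simp only [id] at this
    have e := this.fderiv
    rw [show (-fun y => k * (‖x - y‖ ^ 2 + (τ - s) ^ 2)) =
      fun y => -(k * (‖x - y‖ ^ 2 + (τ - s) ^ 2)) from rfl] at e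
    rw [e]
    simp [inner_sub_left]
    ring
  obtain ⟨u, hu, hlt⟩ := hH y (fderiv ℝ (fun y => -(k * (‖x - y‖ ^ 2 + (τ - s) ^ 2))) y)
    (ω - 2 * k * (τ - s)) (by rw [hd] at h; linarith)
  rw [hg] at hlt
  exact ⟨u, hu, by linarith⟩

/-- Growth of the quadratic penalty when `(x, τ)` moves to `(x', τ + h)` with a velocity that is
close to the velocity `v` aimed at `y`. -/
theorem penalty_step_le {k h τ s L M : ℝ} (hk : 0 ≤ k) (hh : 0 ≤ h) {x y x' v v' : X}
    (hD : ‖x - y‖ ≤ 1) (hv : ‖v' - v‖ ≤ L * ‖x - y‖)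
    (hspeed : ‖x' - x‖ ≤ M * h) (herr : ‖x' - x - h • v'‖ ≤ L * M * h ^ 2) :
    k * (‖x' - y‖ ^ 2 + (τ + h - s) ^ 2) ≤
      k * (‖x - y‖ ^ 2 + (τ - s) ^ 2) + h * (2 * k * (τ - s) + 2 * k * ⟪x - y, v⟫) +
        2 * L * h * (k * ‖x - y‖ ^ 2) + k * (2 * L * M + M ^ 2 + 1) * h ^ 2 := by
  have e1 : ‖x' - y‖ ^ 2 = ‖x - y‖ ^ 2 + 2 * ⟪x - y, x' - x⟫ + ‖x' - x‖ ^ 2 := by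
    rw [← norm_add_sq_real]; congr 2; abel
  have e2 : ⟪x - y, x' - x⟫ = h * ⟪x - y, v⟫ + h * ⟪x - y, v' - v⟫ +
      ⟪x - y, x' - x - h • v'⟫ := by
    rw [← real_inner_smul_right, ← real_inner_smul_right, ← inner_add_right, ← inner_add_right]
    congr 1
    module
  have i1 : ⟪x - y, v' - v⟫ ≤ L * ‖x - y‖ ^ 2 := by
    refine (real_inner_le_norm _ _).trans ?_
    calc ‖x - y‖ * ‖v' - v‖ ≤ ‖x - y‖ * (L * ‖x - y‖) := by gcongr
      _ = _ := by ring
  have i2 : ⟪x - y, x' - x - h • v'⟫ ≤ L * M * h ^ 2 := by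
    refine (real_inner_le_norm _ _).trans ?_
    calc _ ≤ 1 * (L * M * h ^ 2) := by gcongr
      _ = _ := one_mul _
  have i3 : ‖x' - x‖ ^ 2 ≤ (M * h) ^ 2 := by gcongr
  have i1' := mul_le_mul_of_nonneg_left i1 hh
  have : ‖x' - y‖ ^ 2 + (τ + h - s) ^ 2 ≤ ‖x - y‖ ^ 2 + (τ - s) ^ 2 +
      h * (2 * (τ - s) + 2 * ⟪x - y, v⟫) + 2 * L * h * ‖x - y‖ ^ 2 +
      (2 * L * M + M ^ 2 + 1) * h ^ 2 := by
    rw [e1, e2]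
    nlinarith only [i1', i2, i3]
  calc _ ≤ k * _ := mul_le_mul_of_nonneg_left this hk
    _ = _ := by ring

/-- Proximal aiming: let the set of states `x` with `P τ x` at time `τ` be stable under motion
with constant controls.  If it contains a point at time `a` at which the viscosity solution is
negative, then it contains a point at the final time at which the terminal value is negative.

Along the motion, `V` is replaced by its infimal convolution
`inf {V y s + k * (‖x - y‖ ^ 2 + (τ - s) ^ 2)}` over a compact set, which nearly decreases in each
short step whose control is aimed at a minimiser. -/
theorem IsViscositySolution.exists_terminal_neg [ProperSpace X] {A : Type*} {U : Set A}
    {f : X → A → X} (hU : U.Nonempty)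
    (hlip : ∀ R : ℝ, ∃ L : ℝ, ∀ u ∈ U, ∀ x y : X, ‖x‖ ≤ R → ‖y‖ ≤ R →
      ‖f x u - f y u‖ ≤ L * ‖x - y‖)
    (hgrowth : ∃ K : ℝ, ∀ u ∈ U, ∀ x : X, ‖f x u‖ ≤ K * (1 + ‖x‖))
    {H : X → (X →L[ℝ] ℝ) → ℝ} {b : ℝ} {g : X → ℝ} {V : X → ℝ → ℝ}
    (hV : IsViscositySolution H b g V)
    (hH : ∀ x p c, H x p < c → ∃ u ∈ U, p (f x u) < c)
    {P : ℝ → X → Prop} {a : ℝ} (ha : a ∈ Icc 0 b)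
    (hP : ∀ τ h x u y, a ≤ τ → 0 ≤ h → u ∈ U → P τ x → IsTrajectory f h (fun _ => u) x y →
      P (τ + h) (y h))
    {x₀ : X} (hx₀ : P a x₀) (hneg : V x₀ a < 0) : ∃ y, P b y ∧ g y < 0 := by
  rcases ha.2.eq_or_lt with rfl | hab
  · exact ⟨x₀, hx₀, by rwa [← hV.terminal]⟩
  obtain ⟨u₀, hu₀⟩ := hU
  -- a priori constants: growth `K`, radius `R`, Lipschitz constant `L`, speed `M`
  obtain ⟨K₀, hK₀⟩ := hgrowth
  set K := max K₀ 1
  have hK : 0 < K := lt_max_of_lt_right one_pos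
  set R := (1 + ‖x₀‖) * Real.exp (K * (b - a)) with hRdef
  have hR : 0 < R := by positivity
  obtain ⟨L₀, hL₀⟩ := hlip (R + 1)
  set L := max L₀ 0
  have hL : 0 ≤ L := le_max_right _ _
  have hgrowth : ∀ u ∈ U, ∀ y, ‖f y u‖ ≤ K * (1 + ‖y‖) := fun u hu y => (hK₀ u hu y).trans
    (mul_le_mul_of_nonneg_right (le_max_left _ _) (by positivity))
  have hlip : ∀ u ∈ U, ∀ y z : X, ‖y‖ ≤ R + 1 → ‖z‖ ≤ R + 1 →
      ‖f y u - f z u‖ ≤ L * ‖y - z‖ := fun u hu y z hy hz => (hL₀ u hu y z hy hz).trans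
    (mul_le_mul_of_nonneg_right (le_max_left _ _) (by positivity))
  set M := K * (R + 2) with hMdef
  have hM : 0 < M := by positivity
  -- the growth bound that trajectories from `x₀` satisfy at time `τ`
  let G : ℝ → X → Prop := fun τ x => 1 + ‖x‖ ≤ (1 + ‖x₀‖) * Real.exp (K * (τ - a))
  have hGR : ∀ τ x, τ ≤ b → G τ x → 1 + ‖x‖ ≤ R := fun τ x hτ hG => hG.trans (by
    simp only [hRdef]; gcongr)
  have move : ∀ τ h x u, a ≤ τ → 0 ≤ h → h * M ≤ 1 → τ + h ≤ b → u ∈ U → P τ x → G τ x →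
      ∃ x', P (τ + h) x' ∧ G (τ + h) x' ∧ ‖x' - x‖ ≤ M * h ∧
        ‖x' - x - h • f x u‖ ≤ L * M * h ^ 2 := by
    intro τ h x u hτ hh hhM hτb hu hPx hGx
    have hexp : (1 + ‖x‖) * Real.exp (K * h) ≤
        (1 + ‖x₀‖) * Real.exp (K * (τ + h - a)) := by
      rw [show K * (τ + h - a) = K * (τ - a) + K * h by ring, Real.exp_add, ← mul_assoc]
      exact mul_le_mul_of_nonneg_right hGx (Real.exp_pos _).le
    have hle : (1 + ‖x₀‖) * Real.exp (K * (τ + h - a)) ≤ R := by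
      simp only [hRdef]
      gcongr
    obtain ⟨y, hy, h1, h2, h3⟩ := exists_short_trajectory hK hL (hgrowth u hu) (hlip u hu) hh hhM
      (x := x) (by linarith)
    exact ⟨y h, hP τ h x u y hτ hh hu hPx hy, h1.trans hexp, h2, h3⟩
  clear_value M R K L
  -- the compact set on which `V` is minimised, with its bound and modulus of continuity
  set B : Set (X × ℝ) := Metric.closedBall 0 (R + 1) ×ˢ Icc 0 b with hB
  have hBc : IsCompact B := (isCompact_closedBall _ _).prod isCompact_Icc
  have hVB : ContinuousOn (fun p : X × ℝ => V p.1 p.2) B :=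
    hV.continuousOn.mono (prod_mono (subset_univ _) subset_rfl)
  have memB : ∀ x τ, ‖x‖ ≤ R + 1 → 0 ≤ τ → τ ≤ b → (x, τ) ∈ B := fun x τ h1 h2 h3 =>
    ⟨by simpa using h1, h2, h3⟩
  obtain ⟨C, hC⟩ := hBc.exists_bound_of_continuousOn hVB
  simp only [Real.norm_eq_abs] at hC
  set c := -V x₀ a with hc
  have hc0 : 0 < c := neg_pos.2 hneg
  set ω := min (c / 8) (c / (8 * ((2 + 2 * L) * (b - a)))) with hω
  have hba : 0 < b - a := sub_pos.2 hab
  have hω0 : 0 < ω := lt_min (by positivity) (by positivity)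
  have hωc : ω ≤ c / 8 := min_le_left _ _
  have hωL : ω * (2 + 2 * L) * (b - a) ≤ c / 8 := by
    have h1 : ω ≤ c / (8 * ((2 + 2 * L) * (b - a))) := min_le_right _ _
    rw [le_div_iff₀ (by positivity)] at h1
    linarith
  clear_value c ω
  obtain ⟨ρ, hρ, hmod⟩ := Metric.uniformContinuousOn_iff.1
    (hBc.uniformContinuousOn_of_continuous hVB) ω hω0
  have hmod : ∀ x τ y s, (x, τ) ∈ B → (y, s) ∈ B → ‖x - y‖ < ρ → |τ - s| < ρ →
      |V x τ - V y s| < ω := fun x τ y s h1 h2 h3 h4 => by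
    have := hmod (x, τ) h1 (y, s) h2 (by
      rw [Prod.dist_eq, dist_eq_norm, Real.dist_eq]; exact max_lt h3 h4)
    rwa [Real.dist_eq] at this
  -- margin at both ends of the horizon, where the viscosity inequality is not available
  obtain ⟨δ, hδ, hδb, hδρ, hδM, hδMρ⟩ : ∃ δ > 0, δ < (b - a) / 2 ∧ δ < ρ ∧ δ * M ≤ 1 ∧
      M * δ < ρ := by
    refine ⟨min (min ((b - a) / 4) (ρ / 2)) (min (1 / M) (ρ / 2 / M)), by positivity,
      ?_, ?_, ?_, ?_⟩
    · exact ((min_le_left _ _).trans (min_le_left _ _)).trans_lt (by linarith)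
    · exact ((min_le_left _ _).trans (min_le_right _ _)).trans_lt (by linarith)
    · rw [← le_div_iff₀ hM]
      exact (min_le_right _ _).trans (min_le_left _ _)
    · have : min (min ((b - a) / 4) (ρ / 2)) (min (1 / M) (ρ / 2 / M)) ≤ ρ / 2 / M :=
        (min_le_right _ _).trans (min_le_right _ _)
      rw [le_div_iff₀ hM] at this
      linarith
  -- penalty weight: minimisers are within distance `min ρ δ` and `1` of `(x, τ)`
  set r := min (min ρ δ) 1 with hr
  have hr0 : 0 < r := by positivity
  have hC0 : 0 ≤ C := (abs_nonneg _).trans (hC (x₀, a) (memB x₀ a (by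
    have := hGR a x₀ hab.le (by simp [G]); linarith) ha.1 ha.2))
  set k := (2 * C + 1) / r ^ 2 with hk
  have hk0 : 0 < k := by positivity
  set N := k * (2 * L * M + M ^ 2 + 1) with hN
  have hN0 : 0 < N := by positivity
  have hkr : k * r ^ 2 = 2 * C + 1 := by rw [hk]; field_simp
  have hr1 : r ≤ 1 := min_le_right _ _
  have hrδ : r ≤ δ := (min_le_left _ _).trans (min_le_right _ _)
  have hrρ : r ≤ ρ := (min_le_left _ _).trans (min_le_left _ _)
  clear_value N k r
  obtain ⟨h₀, hh₀0, hh₀M, hh₀N⟩ : ∃ h₀ > 0, h₀ ≤ 1 / M ∧ h₀ ≤ ω / N :=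
    ⟨min (1 / M) (ω / N), by positivity, min_le_left _ _, min_le_right _ _⟩
  have hnear : ∀ x y : X, ∀ τ s, (x, τ) ∈ B → (y, s) ∈ B →
      V y s + k * (‖x - y‖ ^ 2 + (τ - s) ^ 2) ≤ V x τ →
      ‖x - y‖ < r ∧ |τ - s| < r ∧ k * ‖x - y‖ ^ 2 ≤ ω := by
    intro x y τ s hx hy hle
    have h1 := abs_le.1 (hC _ hx)
    have h2 := abs_le.1 (hC _ hy)
    simp only at h1 h2
    have h3 : ‖x - y‖ ^ 2 + (τ - s) ^ 2 < r ^ 2 := by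
      have : k * (‖x - y‖ ^ 2 + (τ - s) ^ 2) < k * r ^ 2 := by
        rw [hkr]
        linarith [h1.2, h2.1]
      exact lt_of_mul_lt_mul_left this hk0.le
    have h4 : ‖x - y‖ < r := lt_of_pow_lt_pow_left₀ 2 hr0.le (by
      linarith only [h3, sq_nonneg (τ - s)])
    have h5 : |τ - s| < r := lt_of_pow_lt_pow_left₀ 2 hr0.le (by
      rw [sq_abs]; linarith only [h3, sq_nonneg ‖x - y‖])
    have h6 := (abs_lt.1 (hmod x τ y s hx hy (h4.trans_le hrρ) (h5.trans_le hrρ))).2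
    refine ⟨h4, h5, ?_⟩
    have : 0 ≤ k * (τ - s) ^ 2 := by positivity
    linarith
  -- an arbitrary control up to time `a + δ`: by continuity `V` stays negative
  have hstart : G a x₀ := by simp [G]
  obtain ⟨x₁, hP₁, hG₁, hd₁, -⟩ := move a δ x₀ u₀ le_rfl hδ.le hδM (by linarith) hu₀ hx₀ hstart
  have hBof : ∀ x τ, a ≤ τ → τ ≤ b → G τ x → (x, τ) ∈ B := fun x τ h1 h2 h3 =>
    memB x τ (by linarith [hGR τ x h2 h3]) (ha.1.trans h1) h2
  have hV₁ : V x₁ (a + δ) < -c + ω := by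
    have := (abs_lt.1 (hmod x₁ (a + δ) x₀ a (hBof _ _ (by linarith) (by linarith) hG₁)
      (hBof _ _ le_rfl hab.le hstart) (hd₁.trans_lt hδMρ) (by simpa [abs_of_pos hδ]))).2
    linarith
  -- aiming from `a + δ` to `b - δ`: the minimum grows at most at the rate `ω * (2 + 2 * L)`
  obtain ⟨x₂, hP₂, hG₂, y, s, hys, hle⟩ := exists_of_small_steps (a := a + δ) (b := b - δ)
    (Q := fun τ x => P τ x ∧ G τ x ∧ ∃ y s, (y, s) ∈ B ∧
      V y s + k * (‖x - y‖ ^ 2 + (τ - s) ^ 2) ≤ -c + ω + ω * (2 + 2 * L) * (τ - (a + δ)))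
    (by linarith) hh₀0
    (by
      rintro τ h x hτ hh hhh₀ hτh ⟨hPx, hGx, y₀, s₀, hB₀, hle₀⟩
      have hxB := hBof x τ (by linarith) (by linarith) hGx
      obtain ⟨⟨y, s⟩, hysB, hmin⟩ := hBc.exists_isMinOn (f := fun p : X × ℝ => V p.1 p.2 +
        k * (‖x - p.1‖ ^ 2 + (τ - p.2) ^ 2)) ⟨_, hB₀⟩ (hVB.add (by fun_prop))
      have hmin' := isMinOn_iff.1 hmin
      have hmx := hmin' _ hxB
      simp only [sub_self, norm_zero, ne_eq, OfNat.ofNat_ne_zero, not_false_eq_true, zero_pow,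
        add_zero, mul_zero] at hmx
      obtain ⟨hxy, hτs, hkω⟩ := hnear x y τ s hxB hysB hmx
      have hτs' := abs_lt.1 (hτs.trans_le hrδ)
      have hs : s ∈ Ioo 0 b := ⟨by linarith [ha.1], by linarith⟩
      have hyR : ‖y‖ < R + 1 := by
        have h1 := hGR τ x (by linarith) hGx
        have h2 := norm_le_norm_add_norm_sub x y
        linarith
      have hnhds : B ∈ nhds (y, s) := prod_mem_nhds
        (Filter.mem_of_superset (Metric.isOpen_ball.mem_nhds (by simpa using hyR))
          Metric.ball_subset_closedBall)
        (Icc_mem_nhds hs.1 hs.2)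
      obtain ⟨u, hu, haim⟩ := hV.exists_aiming_control hH hs hω0 (hmin.isLocalMin hnhds)
      obtain ⟨x', hPx', hGx', hspeed, herr⟩ := move τ h x u (by linarith) hh.le
        ((le_div_iff₀ hM).1 (hhh₀.trans hh₀M)) (by linarith) hu hPx hGx
      refine ⟨x', hPx', hGx', y, s, hysB, ?_⟩
      have hstep := penalty_step_le (τ := τ) (s := s) hk0.le hh.le (hxy.le.trans hr1)
        (hlip u hu x y (by linarith [hGR τ x (by linarith) hGx]) hyR.le) hspeed herr
      have h1 := (hmin' _ hB₀).trans hle₀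
      simp only at h1
      have h2 := mul_le_mul_of_nonneg_left haim.le hh.le
      have h3 : 2 * L * h * (k * ‖x - y‖ ^ 2) ≤ 2 * L * h * ω :=
        mul_le_mul_of_nonneg_left hkω (by positivity)
      have h4 : N * h ^ 2 ≤ h * ω := by
        have : h * N ≤ ω := (le_div_iff₀ hN0).1 (hhh₀.trans hh₀N)
        nlinarith only [this, hh]
      rw [← hN] at hstep
      linear_combination hstep + h1 + h2 + h3 + h4)
    ⟨hP₁, hG₁, x₁, a + δ, hBof _ _ (by linarith) (by linarith) hG₁, by simpa using hV₁.le⟩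
  have hx₂B := hBof x₂ (b - δ) (by linarith) (by linarith) hG₂
  -- compare the value at `x₂` with the minimum of the penalised function
  have hV₂ : V x₂ (b - δ) < -c + 4 * (c / 8) := by
    have hLδ : ω * (2 + 2 * L) * (b - δ - (a + δ)) ≤ c / 8 := by
      refine le_trans (mul_le_mul_of_nonneg_left ?_ (by positivity)) hωL
      linarith
    by_cases hcase : V y s + k * (‖x₂ - y‖ ^ 2 + (b - δ - s) ^ 2) ≤ V x₂ (b - δ)
    · obtain ⟨h1, h2, -⟩ := hnear x₂ y _ s hx₂B hys hcase
      have h3 := (abs_lt.1 (hmod x₂ _ y s hx₂B hys (h1.trans_le hrρ) (h2.trans_le hrρ))).2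
      have : 0 ≤ k * (‖x₂ - y‖ ^ 2 + (b - δ - s) ^ 2) := by positivity
      linarith
    · linarith
  -- an arbitrary control up to the final time
  obtain ⟨x₃, hP₃, hG₃, hd₃, -⟩ := move (b - δ) δ x₂ u₀ (by linarith) hδ.le hδM (by linarith) hu₀
    hP₂ hG₂
  rw [sub_add_cancel] at hP₃ hG₃
  refine ⟨x₃, hP₃, ?_⟩
  have := (abs_lt.1 (hmod x₃ b x₂ (b - δ) (hBof _ _ hab.le le_rfl hG₃) hx₂B
    (hd₃.trans_lt hδMρ) (by simpa [abs_of_pos hδ]))).2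
  rw [← hV.terminal]
  linarith

end Descent

/-! ### From negative values to trajectories -/

/-- A strict upper bound of the two-agent Hamiltonian is undercut by a pair of controls.  The infima
need not be bounded below for this. -/
theorem exists_lt_of_twoAgentHamiltonian_lt {X : Type*} [NormedAddCommGroup X] [NormedSpace ℝ X]
    {A B : Type*} {UE : Set A} {UC : Set B} (hE : UE.Nonempty) (hC : UC.Nonempty)
    {f : X → A → B → X} {x : X} {p : X →L[ℝ] ℝ} {c : ℝ} (h : twoAgentHamiltonian UE UC f x p < c) :
    ∃ u ∈ UE ×ˢ UC, p (f x u.1 u.2) < c := by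
  obtain ⟨_, ⟨uC, huC, rfl⟩, h⟩ := exists_lt_of_csInf_lt (hC.image _) h
  obtain ⟨_, ⟨uE, huE, rfl⟩, h⟩ := exists_lt_of_csInf_lt (hE.image _) h
  exact ⟨(uE, uC), ⟨huE, huC⟩, h⟩

/-- If a viscosity solution is negative at `(x₀, 0)`, then some trajectory from `x₀` has negative
terminal value.  Of the Hamiltonian only the half `H x p ≥ inf {p (f x u)}` matters. -/
theorem RegularDynamics.exists_trajectory_terminal_neg {X : Type*} [NormedAddCommGroup X]
    [InnerProductSpace ℝ X] [ProperSpace X] {A : Type*} [TopologicalSpace A] [MeasurableSpace A]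
    {U : Set A} {f : X → A → X} (hf : RegularDynamics U f)
    {H : X → (X →L[ℝ] ℝ) → ℝ} {b : ℝ} (hb : 0 ≤ b) {g : X → ℝ} {V : X → ℝ → ℝ}
    (hV : IsViscositySolution H b g V)
    (hH : ∀ x p c, H x p < c → ∃ u ∈ U, p (f x u) < c) {x₀ : X} (hneg : V x₀ 0 < 0) :
    ∃ u x, IsControl U b u ∧ IsTrajectory f b u x₀ x ∧ g (x b) < 0 := by
  obtain ⟨u₀, hu₀⟩ := hf.nonempty
  obtain ⟨_, ⟨-, u, x, hu, hx, rfl⟩, hg⟩ := hV.exists_terminal_neg hf.nonempty hf.locallyLipschitz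
    hf.linearGrowth hH (a := 0) (x₀ := x₀) ⟨le_rfl, hb⟩
    (P := fun τ x' => 0 ≤ τ ∧ ∃ u x, IsControl U τ u ∧ IsTrajectory f τ u x₀ x ∧ x τ = x')
    (by
      rintro τ h _ v y hτ hh hv ⟨-, u, x, hu, hx, rfl⟩ hy
      have hy0 : y 0 = x τ := by simpa using hy.eq_integral 0 ⟨le_rfl, hh⟩
      refine ⟨add_nonneg hτ hh, _, _, hu.concat_const hv, hx.concat hτ hh hy, ?_⟩
      rcases hh.eq_or_lt with rfl | hh
      · simp [hy0]
      · simp [hh])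
    ⟨le_rfl, fun _ => u₀, fun _ => x₀, ⟨measurable_const, fun _ _ => hu₀⟩,
      ⟨continuousOn_const, by simp, fun τ hτ => by simp [le_antisymm hτ.2 hτ.1]⟩, rfl⟩ hneg
  exact ⟨u, x, hu, hx, hg⟩

/-- If the solution of the Hamilton–Jacobi equation for reaching a target at any time is negative
at the end point `(x a, a)` of a trajectory on `[0, a]`, then that trajectory can be prolonged to
the whole horizon so that it visits the set `{g < 0}` after time `a`.

The Hamiltonian belongs to the system that may also wait, with velocity `0`.  As the dynamics are
autonomous, leaving out the waiting periods turns its trajectories into trajectories of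
the original system that arrive earlier at the same states. -/
theorem RegularDynamics.exists_prolongation_reaching {X : Type*} [NormedAddCommGroup X]
    [InnerProductSpace ℝ X] [ProperSpace X] {A : Type*} [TopologicalSpace A] [MeasurableSpace A]
    {U : Set A} {f : X → A → X} (hf : RegularDynamics U f)
    {b : ℝ} {g : X → ℝ} {V : X → ℝ → ℝ}
    (hV : IsViscositySolution (reachAnytimeHamiltonian U f) b g V)
    {a : ℝ} (ha : a ∈ Icc 0 b) {u : ℝ → A} {x₀ : X} {x : ℝ → X} (hu : IsControl U a u)
    (hx : IsTrajectory f a u x₀ x) (hneg : V (x a) a < 0) :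
    ∃ v y, IsControl U b v ∧ IsTrajectory f b v x₀ y ∧ (∀ τ ≤ a, v τ = u τ) ∧
      (∀ τ ≤ a, y τ = x τ) ∧ ∃ s ∈ Icc a b, g (y s) < 0 := by
  obtain ⟨u₀, hu₀⟩ := hf.nonempty
  obtain ⟨_, ⟨s, hs, v, y, hv, hy, hvu, hyx, rfl⟩, hg⟩ := hV.exists_terminal_neg
    (U := insert none (some '' U)) (f := fun x o => o.elim 0 (f x)) (a := a) (x₀ := x a)
    (insert_nonempty _ _)
    (by
      intro R
      obtain ⟨L, hL⟩ := hf.locallyLipschitz R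
      refine ⟨max L 0, ?_⟩
      rintro _ (rfl | ⟨w, hw, rfl⟩) z z' hz hz'
      · simp only [Option.elim_none, sub_self, norm_zero]
        positivity
      · exact (hL w hw z z' hz hz').trans
          (mul_le_mul_of_nonneg_right (le_max_left _ _) (norm_nonneg _)))
    (by
      obtain ⟨K, hK⟩ := hf.linearGrowth
      refine ⟨max K 0, ?_⟩
      rintro _ (rfl | ⟨w, hw, rfl⟩) z
      · simp only [Option.elim_none, norm_zero]
        positivity
      · exact (hK w hw z).trans (mul_le_mul_of_nonneg_right (le_max_left _ _) (by positivity)))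
    (by
      intro z p c h
      rcases min_lt_iff.1 h with h | h
      · exact ⟨none, mem_insert _ _, by simpa using h⟩
      · obtain ⟨_, ⟨w, hw, rfl⟩, h⟩ := exists_lt_of_csInf_lt (hf.nonempty.image _) h
        exact ⟨some w, mem_insert_of_mem _ (mem_image_of_mem _ hw), h⟩)
    (P := fun τ x' => ∃ s ∈ Icc a τ, ∃ v y, IsControl U s v ∧ IsTrajectory f s v x₀ y ∧
      (∀ τ ≤ a, v τ = u τ) ∧ (∀ τ ≤ a, y τ = x τ) ∧ y s = x') ha
    (by
      rintro τ h _ o y' hτ hh ho ⟨s, hs, v, y, hv, hy, hvu, hyx, rfl⟩ hy'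
      have hy0 : y' 0 = y s := by simpa using hy'.eq_integral 0 ⟨le_rfl, hh⟩
      rcases ho with rfl | ⟨w, hw, rfl⟩
      · have : y' h = y s := by simpa using hy'.eq_integral h ⟨hh, le_rfl⟩
        exact ⟨s, ⟨hs.1, hs.2.trans (by linarith)⟩, v, y, hv, hy, hvu, hyx, this.symm⟩
      · have hy' : IsTrajectory f h (fun _ => w) (y s) y' :=
          ⟨hy'.continuousOn, hy'.integrable, hy'.eq_integral⟩
        refine ⟨s + h, ⟨by linarith [hs.1], by linarith [hs.2]⟩, _, _, hv.concat_const hw,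
          hy.concat (ha.1.trans hs.1) hh hy', fun r hr => ?_, fun r hr => ?_, ?_⟩
        · simp [hr.trans hs.1, hvu r hr]
        · simp [hr.trans hs.1, hyx r hr]
        · rcases hh.eq_or_lt with rfl | hh
          · simp [hy0]
          · simp [hh])
    ⟨a, ⟨le_rfl, le_rfl⟩, u, x, hu, hx, fun _ _ => rfl, fun _ _ => rfl, rfl⟩ hneg
  -- the remaining time after the arrival at `s` is filled with a constant control
  obtain ⟨y', hy'⟩ := hf.exists_trajectory hu₀ (y s) (sub_nonneg.2 hs.2)
  have hv' := hv.concat_const (h := b - s) hu₀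
  have hyc := hy.concat (ha.1.trans hs.1) (sub_nonneg.2 hs.2) hy'
  rw [add_sub_cancel] at hv' hyc
  refine ⟨_, _, hv', hyc, fun r hr => ?_, fun r hr => ?_, s, hs, ?_⟩
  · simp [hr.trans hs.1, hvu r hr]
  · simp [hr.trans hs.1, hyx r hr]
  · simpa using hg

/-- A linear map that intertwines two dynamics maps trajectories to trajectories. -/
theorem IsTrajectory.map {X Y : Type*} [NormedAddCommGroup X] [NormedSpace ℝ X] [CompleteSpace X]
    [NormedAddCommGroup Y] [NormedSpace ℝ Y] [CompleteSpace Y] {A B : Type*} {f : X → A → X}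
    {F : Y → B → Y} (π : X →L[ℝ] Y) {b : ℝ} (hb : 0 ≤ b) {u : ℝ → A} {v : ℝ → B} {x₀ : X}
    {x : ℝ → X} (hx : IsTrajectory f b u x₀ x)
    (hπ : ∀ s ∈ Icc 0 b, π (f (x s) (u s)) = F (π (x s)) (v s)) :
    IsTrajectory F b v (π x₀) (fun s => π (x s)) := by
  refine ⟨π.continuous.comp_continuousOn hx.continuousOn, ?_, fun τ hτ => ?_⟩
  · refine IntervalIntegrable.congr (f := fun s => π (f (x s) (u s))) (fun s hs => ?_)
      ⟨π.integrable_comp hx.integrable.1, π.integrable_comp hx.integrable.2⟩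
    rw [uIoc_of_le hb] at hs
    exact hπ s (Ioc_subset_Icc_self hs)
  · have hI : IntervalIntegrable (fun s => f (x s) (u s)) volume 0 τ :=
      hx.integrable.mono_set (by
        rw [uIcc_of_le hτ.1, uIcc_of_le hb]; exact Icc_subset_Icc_right hτ.2)
    rw [hx.eq_integral τ hτ, map_add, ← π.intervalIntegral_comp_comm hI]
    congr 1
    refine intervalIntegral.integral_congr fun s hs => ?_
    rw [uIcc_of_le hτ.1] at hs
    exact hπ s ⟨hs.1, hs.2.trans hτ.2⟩

/-! ### Collision followed by completion of the maneuver -/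

theorem mainTheorem1
    (n nE mE mC : ℕ)
    -- control sets of the ego and of the contender
    (UE : Set (RVec mE)) (UC : Set (RVec mC))
    -- ego dynamics, joint dynamics, and the projection from joint states to ego states
    (fE : RVec nE → RVec mE → RVec nE)
    (f : RVec n → RVec mE → RVec mC → RVec n)
    (π : RVec n →L[ℝ] RVec nE)
    (hfE : RegularDynamics UE fE)
    (hf : RegularDynamics (UE ×ˢ UC) (fun z (u : RVec mE × RVec mC) => f z u.1 u.2))
    (hπ : ∀ z, ∀ uE ∈ UE, ∀ uC ∈ UC, π (f z uE uC) = fE (π z) uE)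
    -- maneuver set and collision set with their boundary value functions
    (CE : Set (RVec nE)) (GE : RVec nE → ℝ) (hCE : ∀ x, x ∈ CE ↔ GE x ≤ 0)
    (Col : Set (RVec n)) (Gcol : RVec n → ℝ) (hCol : ∀ z, z ∈ Col ↔ Gcol z ≤ 0)
    -- horizon
    (T : ℝ) (hT : 0 ≤ T)
    -- ego-only value function
    (VE : RVec nE → ℝ → ℝ)
    (hVE : IsViscositySolution (reachAnytimeHamiltonian UE fE) T GE VE)
    -- `Vt t z τ` is the value at `(z, τ)` of the function with terminal condition at time `t`
    (Vt : ℝ → RVec n → ℝ → ℝ)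
    (hVt : ∀ t ∈ Icc 0 T, IsViscositySolution (twoAgentHamiltonian UE UC f) t
      (fun z => max (VE (π z) t) (Gcol z)) (Vt t))
    -- `V z` is the minimum (more generally, the infimum) over `t` of the initial values
    (V : RVec n → ℝ)
    (hV : ∀ z, IsGLB ((fun t => Vt t z 0) '' Icc 0 T) (V z))
    (z₀ : RVec n) (hz₀ : V z₀ < 0) :
    ∃ t ∈ Icc 0 T, ∃ (uE : ℝ → RVec mE) (uC : ℝ → RVec mC),
      IsControl UE T uE ∧ IsControl UC t uC ∧
      ∃ (z : ℝ → RVec n) (zE : ℝ → RVec nE),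
        IsTrajectory (fun x (u : RVec mE × RVec mC) => f x u.1 u.2) t
          (fun s => (uE s, uC s)) z₀ z ∧
        IsTrajectory fE T uE (π z₀) zE ∧
        (∀ τ ∈ Icc 0 t, zE τ = π (z τ)) ∧
        z t ∈ Col ∧
        ∃ s ∈ Icc t T, zE s ∈ CE := by
  obtain ⟨_, ⟨t, ht, rfl⟩, hneg⟩ := (isGLB_lt_iff (hV z₀)).1 hz₀
  have hne := hf.nonempty
  obtain ⟨u, z, hu, hz, hg⟩ := hf.exists_trajectory_terminal_neg ht.1 (hVt t ht)
    (fun _ _ _ h => exists_lt_of_twoAgentHamiltonian_lt hne.fst hne.snd h) hneg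
  obtain ⟨hVneg, hcol⟩ := max_lt_iff.1 hg
  have huE : IsControl UE t (fun s => (u s).1) :=
    ⟨hu.1.fst, fun τ hτ => (hu.2 τ hτ).1⟩
  have hzE : IsTrajectory fE t (fun s => (u s).1) (π z₀) (fun s => π (z s)) :=
    hz.map π ht.1 fun s hs => hπ _ _ (hu.2 s hs).1 _ (hu.2 s hs).2
  obtain ⟨v, zE, hv, hzE, hvu, hzEz, s, hs, hGs⟩ :=
    hfE.exists_prolongation_reaching hVE ht huE hzE hVneg
  have hcongr : ∀ τ ∈ Icc 0 t, EqOn (fun s => f (z s) (u s).1 (u s).2)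
      (fun s => f (z s) (v s) (u s).2) (uIcc 0 τ) := by
    intro τ hτ s hs
    rw [uIcc_of_le hτ.1] at hs
    simp only [hvu s (hs.2.trans hτ.2)]
  refine ⟨t, ht, v, fun s => (u s).2, hv, ⟨hu.1.snd, fun τ hτ => (hu.2 τ hτ).2⟩, z, zE,
    ⟨hz.continuousOn, ?_, fun τ hτ => ?_⟩, hzE, fun τ hτ => hzEz τ hτ.2, (hCol _).2 hcol.le,
    s, hs, (hCE _).2 hGs.le⟩
  · exact hz.integrable.congr ((hcongr t ⟨ht.1, le_rfl⟩).mono uIoc_subset_uIcc)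
  · rw [hz.eq_integral τ hτ, intervalIntegral.integral_congr (hcongr τ hτ)]
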